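/- Let $X$ be a metric space, let $I=[a,b]$ be a compact interval ($a\le b$), let $\gamma:I\to X$ be a Lipschitz path, and let $f,g:X\to\mathbb{R}$ be Lipschitz functions. For any Lipschitz path $\sigma:J\to X$ on a compact interval $J$ and any Lipschitz $\varphi,\psi:X\to\mathbb{R}$ set $$\int_\sigma \varphi\,d\psi := \int_J \varphi(\sigma(t))\,(\psi\circ\sigma)'(t)\,dt ,$$ where the derivative exists for a.e. $t\in J$. We say that $\sigma$ has \emph{degree zero} if $\int_\sigma \varphi\,d\psi=0$ for all Lipschitz functions $\varphi,\psi:X\to\mathbb{R}$. The \emph{multiplicity} of $\gamma$ at $x\in X$ is $m(\gamma,x):=\#\,\gamma^{-1}(x)\in\{0,1,2,\dots\}\cup\{+\infty\}$, and $\mathscr{H}^1$ is the one-dimensional Hausdorff measure on $X$. Then the following statements hold. (i) [Invariance under reparametrization] Let $I'$ be a compact interval and let $\tau:I'\to I$ be an increasing homeomorphism such that $\gamma\circ\tau$ is Lipschitz. Then $\int_\gamma f\,dg=\int_{\gamma\circ\tau} f\,dg$. In particular, $\gamma$ has degree zero if and only if $\gamma\circ\tau$ has degree zero. (ii) [Stability]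 Let $\gamma_n:I\to X$, $n\in\mathbb{N}$, be paths which are uniformly Lipschitz (that is, Lipschitz with a common constant) and converge uniformly to $\gamma$. Then $\int_{\gamma_n} f\,dg\to\int_\gamma f\,dg$ as $n\to+\infty$. In particular, if each $\gamma_n$ has degree zero, then $\gamma$ has degree zero. (iii) [Parity] If $\gamma$ has degree zero, then the multiplicity $m(\gamma,x)$ is finite and even for $\mathscr{H}^1$-a.e. $x\in X$. -/

import Mathlib

open Set Filter MeasureTheory

/-- The integral `∫_γ f dg = ∫_I (f ∘ γ) · (d/dt)(g ∘ γ) dt` along a path `γ : I → X`, where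
`I = [a, b]`. To use Mathlib's one-variable derivative, `γ` is extended to `ℝ` by its endpoint
values; this has no influence on the derivative at the interior points of `I`. -/
noncomputable def pathIntegral {X : Type*} {a b : ℝ} (hab : a ≤ b) (γ : Icc a b → X)
    (f g : X → ℝ) : ℝ :=
  ∫ t in a..b, f (IccExtend hab γ t) * deriv (fun s => g (IccExtend hab γ s)) t

/-- `γ` has degree zero: `∫_γ f dg = 0` for all Lipschitz functions `f, g : X → ℝ`. -/
def HasDegreeZero {X : Type*} [MetricSpace X] {a b : ℝ} (hab : a ≤ b)
    (γ : Icc a b → X) : Prop :=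
  ∀ f g : X → ℝ, (∃ K, LipschitzWith K f) → (∃ K, LipschitzWith K g) →
    pathIntegral hab γ f g = 0

/-- The multiplicity `m(γ, x) = #γ⁻¹(x)`, possibly `+∞`. -/
noncomputable def pathMultiplicity {X : Type*} {a b : ℝ} (γ : Icc a b → X) (x : X) : ℕ∞ :=
  (γ ⁻¹' {x}).encard

/-- For Lipschitz data the integrand of `pathIntegral` is integrable, and its derivative factor
exists at almost every point, so that the integral is a genuine one. -/
theorem pathIntegral_wellDefined {X : Type*} [MetricSpace X] {a b : ℝ} (hab : a ≤ b)
    (γ : Icc a b → X) (hγ : ∃ K, LipschitzWith K γ) (f g : X → ℝ)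
    (hf : ∃ K, LipschitzWith K f) (hg : ∃ K, LipschitzWith K g) :
    (∀ᵐ t : ℝ, DifferentiableAt ℝ (fun s => g (IccExtend hab γ s)) t) ∧
      IntervalIntegrable
        (fun t => f (IccExtend hab γ t) * deriv (fun s => g (IccExtend hab γ s)) t)
        volume a b := by
  obtain ⟨K, hK⟩ := hγ
  obtain ⟨L, hL⟩ := hf
  obtain ⟨M, hM⟩ := hg
  have hE : LipschitzWith (K * 1) (IccExtend hab γ) := hK.comp (LipschitzWith.projIcc hab)
  have hgE : LipschitzWith (M * (K * 1)) (fun s => g (IccExtend hab γ s)) := hM.comp hE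
  have hfE : Continuous (fun t => f (IccExtend hab γ t)) := hL.continuous.comp hE.continuous
  refine ⟨hgE.ae_differentiableAt_real, ?_⟩
  have hd : IntervalIntegrable (deriv (fun s => g (IccExtend hab γ s))) volume a b := by
    refine (intervalIntegrable_const (c := ((M * (K * 1) : NNReal) : ℝ))).mono_fun
      (measurable_deriv _).aestronglyMeasurable (Eventually.of_forall fun t => ?_)
    simpa using norm_deriv_le_of_lipschitz (x₀ := t) hgE
  exact hd.continuousOn_mul hfE.continuousOn

/-! For (i) and (ii), the integral differs from a Riemann–Stieltjes sum by an error controlled by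
the oscillation of `f ∘ γ` and the Lipschitz constant of `g ∘ γ` only. Such a sum sees only the
values of the path at the partition points, so it is unchanged under reparametrization and
continuous under pointwise convergence.

For (iii), fix a Lipschitz `g` and put `h = g ∘ γ`. Degree zero says that the signed measure `h' dt`
has zero pushforward to `X`. Localized to a small ball and combined with the area formula, this
shows that over almost every level `s` of `g` the preimages of a point with `h' > 0` are as many as
those with `h' < 0`. Almost every level has only preimages with `h' ≠ 0`, and these are finitely
many, so the multiplicity is finite and even there (`HasDegreeZero.ae_forall_even`).

To pass from levels to `X`, let `E` be the exceptional set. Its image under each distance function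
is null, so almost everywhere on `γ⁻¹(E)` the distances to a countable dense set of points of the
curve all have zero derivative. The set of all times with this property has negligible image
(`LipschitzWith.hausdorffMeasure_image_eq_zero`). -/

/-- The Riemann–Stieltjes sum of `f dg` along `γ` over the partition points `p 0, …, p n`. -/
noncomputable def stieltjesSum {X : Type*} {a b : ℝ} (γ : Icc a b → X) (f g : X → ℝ)
    (p : ℕ → Icc a b) (n : ℕ) : ℝ :=
  ∑ i ∈ Finset.range n, f (γ (p i)) * (g (γ (p (i + 1))) - g (γ (p i)))

theorem LipschitzWith.integral_deriv_eq_sub {v : ℝ → ℝ} {M : NNReal} (hv : LipschitzWith M v)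
    (x y : ℝ) : ∫ t in x..y, deriv v t = v y - v x :=
  (hv.lipschitzOnWith.absolutelyContinuousOnInterval).integral_deriv_eq_sub

theorem LipschitzWith.abs_integral_mul_deriv_sub_le {u v : ℝ → ℝ} {M : NNReal}
    (hu : Continuous u) (hv : LipschitzWith M v) {x y ε : ℝ} (hxy : x ≤ y)
    (hosc : ∀ t ∈ Icc x y, |u t - u x| ≤ ε) :
    |(∫ t in x..y, u t * deriv v t) - u x * (v y - v x)| ≤ ε * M * (y - x) := by
  have hd : IntervalIntegrable (deriv v) volume x y :=
    (hv.lipschitzOnWith.absolutelyContinuousOnInterval).intervalIntegrable_deriv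
  have hε : 0 ≤ ε := (abs_nonneg _).trans (hosc x (left_mem_Icc.2 hxy))
  rw [← hv.integral_deriv_eq_sub, ← intervalIntegral.integral_const_mul,
    ← intervalIntegral.integral_sub (hd.continuousOn_mul hu.continuousOn) (hd.const_mul _),
    ← Real.norm_eq_abs]
  have := intervalIntegral.norm_integral_le_of_norm_le_const (a := x) (b := y) (C := ε * M)
    (f := fun t => u t * deriv v t - u x * deriv v t) ?_
  · rwa [abs_of_nonneg (sub_nonneg.2 hxy)] at this
  · intro t ht
    rw [uIoc_of_le hxy] at ht
    rw [← sub_mul, norm_mul]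
    exact mul_le_mul (hosc t (Ioc_subset_Icc_self ht)) (norm_deriv_le_of_lipschitz hv)
      (norm_nonneg _) hε

/-! ### Riemann–Stieltjes approximation, reparametrization and stability -/

/-- The increments of `g ∘ γ` are exact integrals of its derivative, so only the variation of `f ∘
γ` within each cell is lost. The bound is uniform over paths sharing `M` and `ε`. -/
theorem abs_pathIntegral_sub_stieltjesSum_le {X : Type*} [MetricSpace X] {a b : ℝ} (hab : a ≤ b)
    {γ : Icc a b → X} {f g : X → ℝ} {M : NNReal} (hfγ : Continuous (f ∘ γ))
    (hgγ : LipschitzWith M (g ∘ γ)) {p : ℕ → Icc a b} {n : ℕ} (hp : Monotone p)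
    (h0 : (p 0 : ℝ) = a) (hn : (p n : ℝ) = b) {ε : ℝ}
    (hosc : ∀ i < n, ∀ t ∈ Icc (p i) (p (i + 1)), |f (γ t) - f (γ (p i))| ≤ ε) :
    |pathIntegral hab γ f g - stieltjesSum γ f g p n| ≤ ε * M * (b - a) := by
  set u : ℝ → ℝ := fun t => f (IccExtend hab γ t) with hu_def
  set v : ℝ → ℝ := fun t => g (IccExtend hab γ t) with hv_def
  have hu : Continuous u := hfγ.comp continuous_projIcc
  have hv : LipschitzWith M v := by
    have := hgγ.comp (LipschitzWith.projIcc hab)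
    rwa [mul_one] at this
  have hup (i : ℕ) : u (p i) = f (γ (p i)) := by simp [hu_def]
  have hvp (i : ℕ) : v (p i) = g (γ (p i)) := by simp [hv_def]
  have hint (x y : ℝ) : IntervalIntegrable (fun t => u t * deriv v t) volume x y :=
    ((hv.lipschitzOnWith.absolutelyContinuousOnInterval).intervalIntegrable_deriv).continuousOn_mul
      hu.continuousOn
  have hsum : pathIntegral hab γ f g
      = ∑ i ∈ Finset.range n, ∫ t in (p i : ℝ)..p (i + 1), u t * deriv v t := by
    rw [intervalIntegral.sum_integral_adjacent_intervals (a := fun i => (p i : ℝ))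
      (fun _ _ => hint _ _), h0, hn]
    rfl
  have htel : b - a = ∑ i ∈ Finset.range n, ((p (i + 1) : ℝ) - p i) := by
    rw [Finset.sum_range_sub (fun i => (p i : ℝ)), h0, hn]
  rw [hsum, stieltjesSum, ← Finset.sum_sub_distrib, htel, Finset.mul_sum]
  refine (Finset.abs_sum_le_sum_abs _ _).trans (Finset.sum_le_sum fun i hi => ?_)
  have hle : (p i : ℝ) ≤ p (i + 1) := hp (Nat.le_succ i)
  rw [← hup, ← hvp, ← hvp]
  refine hv.abs_integral_mul_deriv_sub_le hu hle fun t ht => ?_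
  have htI : t ∈ Icc a b := ⟨(p i).2.1.trans ht.1, ht.2.trans (p (i + 1)).2.2⟩
  have := hosc i (Finset.mem_range.1 hi) ⟨t, htI⟩ ht
  rw [hup]
  simpa [hu_def, IccExtend_of_mem hab γ htI] using this

theorem exists_partition_dist_lt {a b : ℝ} (hab : a ≤ b) {δ : ℝ} (hδ : 0 < δ) :
    ∃ (p : ℕ → Icc a b) (n : ℕ), Monotone p ∧ p 0 = ⟨a, left_mem_Icc.2 hab⟩ ∧
      p n = ⟨b, right_mem_Icc.2 hab⟩ ∧
      ∀ i, ∀ t ∈ Icc (p i) (p (i + 1)), dist t (p i) < δ := by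
  obtain ⟨n, hn⟩ := exists_nat_ge ((b - a) / (δ / 2))
  rw [div_le_iff₀ (by positivity)] at hn
  -- Clamping to `[a, b]` makes the sequence stay at `b` once it gets there; the mesh `δ / 2` gives
  -- the strict inequality.
  refine ⟨fun i => projIcc a b hab (a + i * (δ / 2)), n, ?_, ?_, ?_, ?_⟩
  · intro i j hij
    refine monotone_projIcc hab ?_
    gcongr
  · simp
  · exact projIcc_of_right_le hab (by linarith)
  · intro i t ht
    have h1 := (LipschitzWith.projIcc hab).dist_le_mul (a + (i + 1 : ℕ) * (δ / 2))
      (a + i * (δ / 2))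
    have h2 : dist (a + (i + 1 : ℕ) * (δ / 2)) (a + i * (δ / 2)) = δ / 2 := by
      rw [Real.dist_eq]; push_cast
      rw [abs_of_nonneg] <;> nlinarith
    rw [h2, Subtype.dist_eq, Real.dist_eq] at h1
    rw [Subtype.dist_eq, Real.dist_eq, abs_of_nonneg (sub_nonneg.2 (show ((projIcc a b hab (a + i * (δ / 2)) : Icc a b) : ℝ) ≤ t from ht.1))]
    have h3 := le_abs_self
      ((projIcc a b hab (a + (i + 1 : ℕ) * (δ / 2)) : ℝ) - projIcc a b hab (a + i * (δ / 2)))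
    have h4 : (t : ℝ) ≤ projIcc a b hab (a + (i + 1 : ℕ) * (δ / 2)) := ht.2
    simp only [NNReal.coe_one, one_mul] at h1
    linarith

theorem pathIntegral_comp_homeomorph {X : Type*} [MetricSpace X] {a b c d : ℝ} (hab : a ≤ b)
    (hcd : c ≤ d) {γ : Icc a b → X} (τ : Icc c d ≃ₜ Icc a b) (hτ : StrictMono τ)
    (hγ : ∃ K, LipschitzWith K γ) (hγτ : ∃ K, LipschitzWith K (γ ∘ τ))
    {f g : X → ℝ} (hf : ∃ K, LipschitzWith K f) (hg : ∃ K, LipschitzWith K g) :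
    pathIntegral hab γ f g = pathIntegral hcd (γ ∘ τ) f g := by
  obtain ⟨K, hK⟩ := hγ
  obtain ⟨K', hK'⟩ := hγτ
  obtain ⟨L, hL⟩ := hf
  obtain ⟨M, hM⟩ := hg
  refine eq_of_forall_dist_le fun ε hε => ?_
  -- Oscillation `ε / C` makes the two approximation errors add up to at most `ε`; the `+ 1` keeps
  -- `C` positive for degenerate data.
  set C : ℝ := ((M * K : NNReal) : ℝ) * (b - a) + ((M * K' : NNReal) : ℝ) * (d - c) + 1 with hC
  have hC1 : 0 < C := by
    have := mul_nonneg (M * K).coe_nonneg (sub_nonneg.2 hab)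
    have := mul_nonneg (M * K').coe_nonneg (sub_nonneg.2 hcd)
    positivity
  have hcont : Continuous (f ∘ (γ ∘ τ)) := hL.continuous.comp hK'.continuous
  obtain ⟨δ, hδ, hunif⟩ := Metric.uniformContinuous_iff.1
    (CompactSpace.uniformContinuous_of_continuous hcont) (ε / C) (by positivity)
  obtain ⟨p, n, hp, h0, hn, hdist⟩ := exists_partition_dist_lt hcd hδ
  have hosc : ∀ i, ∀ t ∈ Icc (p i) (p (i + 1)),
      |f ((γ ∘ τ) t) - f ((γ ∘ τ) (p i))| ≤ ε / C := fun i t ht =>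
    (hunif (hdist i t ht)).le
  let e : Icc c d ≃o Icc a b := StrictMono.orderIsoOfSurjective τ hτ τ.surjective
  have h1 := abs_pathIntegral_sub_stieltjesSum_le (n := n) hcd hcont (hM.comp hK') hp (by simp [h0])
    (by simp [hn]) (fun i _ => hosc i)
  have h2 := abs_pathIntegral_sub_stieltjesSum_le (p := fun i => τ (p i)) (n := n) (ε := ε / C)
    hab (hL.continuous.comp hK.continuous) (hM.comp hK)
    (fun i j hij => hτ.monotone (hp hij)) ?_ ?_ ?_
  · have h3 : stieltjesSum γ f g (fun i => τ (p i)) n = stieltjesSum (γ ∘ τ) f g p n := rfl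
    rw [h3, abs_sub_comm] at h2
    rw [dist_comm, Real.dist_eq]
    have h4 : ε = ε / C * C := by field_simp
    calc _ = |(pathIntegral hcd (γ ∘ τ) f g - stieltjesSum (γ ∘ τ) f g p n)
          + (stieltjesSum (γ ∘ τ) f g p n - pathIntegral hab γ f g)| := by congr 1; ring
      _ ≤ ε / C * (M * K' : NNReal) * (d - c) + ε / C * (M * K : NNReal) * (b - a) :=
        (abs_add_le _ _).trans (add_le_add h1 h2)
      _ ≤ ε / C * C := by
        rw [hC]
        have : 0 ≤ ε / C := by positivity
        nlinarith
      _ = ε := h4.symm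
  · rw [h0]
    have : e ⟨c, left_mem_Icc.2 hcd⟩ ≤ ⟨a, left_mem_Icc.2 hab⟩ := by
      rw [← e.le_symm_apply]
      exact (e.symm ⟨a, left_mem_Icc.2 hab⟩).2.1
    exact le_antisymm this (τ _).2.1
  · rw [hn]
    have : ⟨b, right_mem_Icc.2 hab⟩ ≤ e ⟨d, right_mem_Icc.2 hcd⟩ := by
      rw [← e.symm_apply_le]
      exact (e.symm ⟨b, right_mem_Icc.2 hab⟩).2.2
    exact le_antisymm (τ _).2.2 this
  · intro i _ t ht
    have ht' : e.symm t ∈ Icc (p i) (p (i + 1)) :=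
      ⟨(e.le_symm_apply).2 ht.1, (e.symm_apply_le).2 ht.2⟩
    have := hosc i _ ht'
    have h5 : τ (e.symm t) = t := e.apply_symm_apply t
    simpa [h5] using this

/-- The common Lipschitz constant lets one partition serve all the paths within `ε / 3`; on it the
sums converge, and pointwise convergence suffices. -/
theorem tendsto_pathIntegral {X : Type*} [MetricSpace X] {a b : ℝ} (hab : a ≤ b)
    {γ : Icc a b → X} {γs : ℕ → Icc a b → X} (hγ : ∃ K, LipschitzWith K γ)
    (hγs : ∃ K, ∀ n, LipschitzWith K (γs n))
    (hlim : ∀ t, Tendsto (fun n => γs n t) atTop (nhds (γ t)))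
    {f g : X → ℝ} (hf : ∃ K, LipschitzWith K f) (hg : ∃ K, LipschitzWith K g) :
    Tendsto (fun n => pathIntegral hab (γs n) f g) atTop (nhds (pathIntegral hab γ f g)) := by
  obtain ⟨K₀, hK₀⟩ := hγ
  obtain ⟨K₁, hK₁⟩ := hγs
  obtain ⟨L, hL⟩ := hf
  obtain ⟨M, hM⟩ := hg
  set K := max K₀ K₁
  have hK : LipschitzWith K γ := hK₀.weaken (le_max_left _ _)
  have hKs (n : ℕ) : LipschitzWith K (γs n) := (hK₁ n).weaken (le_max_right _ _)
  rw [Metric.tendsto_atTop']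
  intro ε hε
  set C : ℝ := ((M * K : NNReal) : ℝ) * (b - a) + 1 with hC
  have hC0 : 0 ≤ ((M * K : NNReal) : ℝ) * (b - a) :=
    mul_nonneg (M * K).coe_nonneg (sub_nonneg.2 hab)
  have hC1 : 0 < C := by positivity
  set η : ℝ := ε / 3 / C with hη
  have hη0 : 0 < η := by positivity
  obtain ⟨p, n, hp, h0, hn, hdist⟩ := exists_partition_dist_lt hab
    (δ := η / ((L * K : NNReal) + 1)) (by positivity)
  have key (σ : Icc a b → X) (hσ : LipschitzWith K σ) :
      |pathIntegral hab σ f g - stieltjesSum σ f g p n| ≤ ε / 3 := by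
    have h1 := abs_pathIntegral_sub_stieltjesSum_le (n := n) hab (hL.continuous.comp hσ.continuous)
      (hM.comp hσ) hp (by simp [h0]) (by simp [hn]) (ε := η) fun i _ t ht => by
        have h2 := (hL.comp hσ).dist_le_mul t (p i)
        have h3 := hdist i t ht
        rw [lt_div_iff₀ (by positivity)] at h3
        rw [Real.dist_eq] at h2
        have : 0 ≤ dist t (p i) := dist_nonneg
        refine h2.trans ?_
        nlinarith
    refine h1.trans ?_
    have h4 : η * C = ε / 3 := by rw [hη]; field_simp
    rw [hC] at h4
    nlinarith
  have hS : Tendsto (fun m => stieltjesSum (γs m) f g p n) atTop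
      (nhds (stieltjesSum γ f g p n)) := by
    refine tendsto_finsetSum _ fun i _ => ?_
    have hft (t) := (hL.continuous.tendsto (γ t)).comp (hlim t)
    have hgt (t) := (hM.continuous.tendsto (γ t)).comp (hlim t)
    exact (hft _).mul ((hgt _).sub (hgt _))
  obtain ⟨N, hN⟩ := (Metric.tendsto_atTop'.1 hS) (ε / 3) (by positivity)
  refine ⟨N, fun m hm => ?_⟩
  have h1 := abs_le.1 (key γ hK)
  have h2 := abs_le.1 (key _ (hKs m))
  have h3 := hN m hm
  rw [Real.dist_eq, abs_lt] at h3 ⊢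
  constructor <;> linarith

/-! ### One-dimensional area formula and critical values -/

/-- Where `h' ≠ 0`, increments of `h` at scales below some `1 / (n + 1)` are at least `1 / (n + 1)`
times those of the variable. Cutting the set `R n` of such points into cells of that length makes
`h` injective on each piece. -/
theorem exists_iUnion_injOn_of_deriv_ne_zero {h : ℝ → ℝ} (hc : Continuous h) :
    ∃ S : ℕ → Set ℝ, (∀ n, MeasurableSet (S n)) ∧ (∀ n, InjOn h (S n)) ∧
      {t | deriv h t ≠ 0} ⊆ ⋃ n, S n := by
  let R : ℕ → Set ℝ := fun n =>
    {t | ∀ s, |s - t| < 1 / (n + 1) → |s - t| / (n + 1) ≤ |h s - h t|}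
  have hR (n : ℕ) : IsClosed (R n) := by
    have : R n = ⋂ s, ({t | 1 / ((n : ℝ) + 1) ≤ |s - t|} ∪
        {t | |s - t| / (n + 1) ≤ |h s - h t|}) := by
      ext t
      simp only [R, mem_ofPred_eq, mem_iInter, mem_union, imp_iff_not_or, not_lt]
    rw [this]
    exact isClosed_iInter fun s => (isClosed_le (by fun_prop) (by fun_prop)).union
      (isClosed_le (by fun_prop) (by fun_prop))
  let T : ℕ × ℤ → Set ℝ := fun q =>
    R q.1 ∩ Ico ((q.2 : ℝ) / (q.1 + 1)) ((q.2 + 1) / (q.1 + 1))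
  obtain ⟨e, he⟩ := exists_surjective_nat (ℕ × ℤ)
  refine ⟨fun n => T (e n), fun n => (hR _).measurableSet.inter measurableSet_Ico, ?_, ?_⟩
  · intro n t ht s hs hts
    have hpos : (0 : ℝ) < (e n).1 + 1 := by positivity
    have h1 := ht.1 s (by
      have h2 := ht.2
      have h3 := hs.2
      have h4 : (((e n).2 : ℝ) + 1) / ((e n).1 + 1)
        = ((e n).2 : ℝ) / ((e n).1 + 1) + 1 / ((e n).1 + 1) := by ring
      rw [h4] at h2 h3
      rw [abs_lt]
      constructor <;> linarith [h2.1, h2.2, h3.1, h3.2])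
    rw [hts, sub_self, abs_zero, div_le_iff₀ hpos, zero_mul] at h1
    exact (sub_eq_zero.1 (abs_nonpos_iff.1 h1)).symm
  · intro t ht
    have hd : HasDerivAt h (deriv h t) t := (differentiableAt_of_deriv_ne_zero ht).hasDerivAt
    have hpos : 0 < |deriv h t| := abs_pos.2 ht
    have ho := (hasDerivAt_iff_isLittleO.1 hd).def (half_pos hpos)
    obtain ⟨δ, hδ, hball⟩ := Metric.eventually_nhds_iff.1 ho
    obtain ⟨n, hn⟩ := exists_nat_one_div_lt (lt_min hδ (half_pos hpos))
    have hRt : t ∈ R n := by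
      intro s hs
      have h1 := hball (y := s) (by
        rw [Real.dist_eq]; exact hs.trans (hn.trans_le (min_le_left _ _)))
      simp only [Real.norm_eq_abs, smul_eq_mul] at h1
      have h2 : |(s - t) * deriv h t| - |h s - h t| ≤ |h s - h t - (s - t) * deriv h t| := by
        rw [abs_sub_comm (h s - h t)]
        exact abs_sub_abs_le_abs_sub _ _
      rw [abs_mul] at h2
      have h3 : 1 / ((n : ℝ) + 1) ≤ |deriv h t| / 2 := (hn.trans_le (min_le_right _ _)).le
      have h4 : |s - t| / (n + 1) = |s - t| * (1 / (n + 1)) := by ring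
      have h5 := mul_le_mul_of_nonneg_left h3 (abs_nonneg (s - t))
      rw [h4]
      linarith
    obtain ⟨m, hm⟩ := he (n, ⌊t * (n + 1)⌋)
    refine mem_iUnion.2 ⟨m, ?_⟩
    rw [hm]
    have hpos' : (0 : ℝ) < n + 1 := by positivity
    exact ⟨hRt, (div_le_iff₀ hpos').2 (Int.floor_le _), (lt_div_iff₀ hpos').2 (Int.lt_floor_add_one _)⟩

/-- The one-dimensional area formula on the set where the derivative does not vanish. -/
theorem setLIntegral_abs_deriv_eq_lintegral_count {h : ℝ → ℝ} (hc : Continuous h) {A : Set ℝ}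
    (hA : MeasurableSet A) (hd : ∀ t ∈ A, deriv h t ≠ 0) :
    ∫⁻ t in A, ENNReal.ofReal |deriv h t| = ∫⁻ s, Measure.count (A ∩ h ⁻¹' {s}) ∧
      Measurable fun s => Measure.count (A ∩ h ⁻¹' {s}) := by
  obtain ⟨S, hS, hinj, hcov⟩ := exists_iUnion_injOn_of_deriv_ne_zero hc
  set D : ℕ → Set ℝ := fun n => A ∩ disjointed S n with hD
  have hDm (n) : MeasurableSet (D n) := hA.inter (MeasurableSet.disjointed hS n)
  have hDd : Pairwise (Function.onFun Disjoint D) := fun i j hij =>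
    (disjoint_disjointed S hij).mono inter_subset_right inter_subset_right
  have hDA : ⋃ n, D n = A := by
    rw [hD, ← inter_iUnion, iUnion_disjointed, inter_eq_left]
    exact fun t ht => hcov (hd t ht)
  have hDinj (n) : InjOn h (D n) :=
    (hinj n).mono (inter_subset_right.trans (disjointed_subset S n))
  have himg (n) : MeasurableSet (h '' D n) :=
    (hDm n).image_of_continuousOn_injOn hc.continuousOn (hDinj n)
  have hcount (n) (s : ℝ) :
      Measure.count (D n ∩ h ⁻¹' {s}) = (h '' D n).indicator (fun _ => (1 : ENNReal)) s := by
    by_cases hs : s ∈ h '' D n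
    · obtain ⟨t, ht, rfl⟩ := hs
      have : D n ∩ h ⁻¹' {h t} = {t} := by
        ext r
        constructor
        · rintro ⟨hr, hr'⟩
          exact hDinj n hr ht hr'
        · rintro rfl
          exact ⟨ht, rfl⟩
      rw [this, Measure.count_singleton, indicator_of_mem (mem_image_of_mem h ht)]
    · have : D n ∩ h ⁻¹' {s} = ∅ := by
        ext r
        simp only [mem_inter_iff, mem_preimage, mem_singleton_iff, mem_empty_iff_false, iff_false]
        rintro ⟨hr, rfl⟩
        exact hs (mem_image_of_mem h hr)
      rw [this, measure_empty, indicator_of_notMem hs]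
  have hsum (s : ℝ) : Measure.count (A ∩ h ⁻¹' {s})
      = ∑' n, (h '' D n).indicator (fun _ => (1 : ENNReal)) s := by
    simp_rw [← hcount]
    rw [← measure_iUnion, ← iUnion_inter, hDA]
    · exact fun i j hij => (hDd hij).mono inter_subset_left inter_subset_left
    · exact fun n => (hDm n).inter (hc.measurable (measurableSet_singleton s))
  have hmeas (n) : Measurable ((h '' D n).indicator (fun _ => (1 : ENNReal))) :=
    measurable_const.indicator (himg n)
  constructor
  · simp_rw [hsum]
    rw [lintegral_tsum fun n => (hmeas n).aemeasurable]
    conv_lhs => rw [← hDA]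
    rw [lintegral_iUnion hDm hDd]
    refine tsum_congr fun n => ?_
    have := lintegral_image_eq_lintegral_abs_deriv_mul (hDm n) (f' := deriv h)
      (fun t ht => ((differentiableAt_of_deriv_ne_zero (hd t ht.1)).hasDerivAt).hasDerivWithinAt)
      (hDinj n) (fun _ => 1)
    simp only [mul_one] at this
    rw [← this, lintegral_indicator (himg n)]
  · simp_rw [hsum]
    exact Measurable.tsum hmeas

/-- A continuous function has almost everywhere vanishing derivative on the preimage of a null
set. -/
theorem ae_deriv_eq_zero_of_mem_null {h : ℝ → ℝ} (hc : Continuous h) {N : Set ℝ}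
    (hN : volume N = 0) : ∀ᵐ t, h t ∈ N → deriv h t = 0 := by
  -- By the area formula, the integral of `|h'|` over `A` is the integral of a fibre count that
  -- vanishes off a null set.
  set A : Set ℝ := {t | deriv h t ≠ 0} ∩ h ⁻¹' (toMeasurable volume N) with hA
  have hAm : MeasurableSet A :=
    ((measurable_deriv h) (measurableSet_singleton (0 : ℝ)).compl).inter
      (hc.measurable (measurableSet_toMeasurable _ _))
  have h1 := (setLIntegral_abs_deriv_eq_lintegral_count hc hAm fun t ht => ht.1).1
  have h2 : ∫⁻ s, Measure.count (A ∩ h ⁻¹' {s}) = 0 := by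
    rw [lintegral_eq_zero_iff' ((setLIntegral_abs_deriv_eq_lintegral_count hc hAm
      fun t ht => ht.1).2.aemeasurable)]
    have h3 : ∀ᵐ s : ℝ, s ∉ toMeasurable volume N := by
      rw [ae_iff]
      simpa using hN
    filter_upwards [h3] with s hs
    have : A ∩ h ⁻¹' {s} = ∅ := by
      ext r
      simp only [mem_inter_iff, mem_preimage, mem_singleton_iff, mem_empty_iff_false, iff_false]
      rintro ⟨hr, rfl⟩
      exact hs hr.2
    simp [this]
  rw [h2, setLIntegral_eq_zero_iff hAm (measurable_deriv h).abs.ennreal_ofReal] at h1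
  filter_upwards [h1] with t ht htN
  by_contra hne
  have := ht ⟨hne, subset_toMeasurable _ _ htN⟩
  rw [ENNReal.ofReal_eq_zero] at this
  exact hne (abs_nonpos_iff.1 this)

theorem volume_image_hasDerivAt_zero (h : ℝ → ℝ) : volume (h '' {t | HasDerivAt h 0 t}) = 0 := by
  refine addHaar_image_eq_zero_of_det_fderivWithin_eq_zero volume
    (f' := fun _ => 0) (fun t ht => ?_) (fun t _ => by simp)
  have := (hasDerivAt_iff_hasFDerivAt.1 ht).hasFDerivWithinAt (s := {t | HasDerivAt h 0 t})
  simpa using this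

/-- Almost every value of a Lipschitz function is attained only at points with nonzero
derivative. -/
theorem LipschitzWith.ae_forall_deriv_ne_zero {h : ℝ → ℝ} {K : NNReal} (hK : LipschitzWith K h) :
    ∀ᵐ s, ∀ t, h t = s → deriv h t ≠ 0 := by
  have hbad : volume (h '' {t | deriv h t = 0}) = 0 := by
    -- `deriv` is also `0` where `h` is not differentiable; those times form a null set, with null
    -- image.
    have hsub : h '' {t | deriv h t = 0} ⊆
        h '' {t | ¬ DifferentiableAt ℝ h t} ∪ h '' {t | HasDerivAt h 0 t} := by
      rintro _ ⟨t, ht, rfl⟩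
      by_cases hd : DifferentiableAt ℝ h t
      · refine Or.inr ⟨t, ?_, rfl⟩
        have := hd.hasDerivAt
        rwa [ht] at this
      · exact Or.inl ⟨t, hd, rfl⟩
    refine measure_mono_null hsub (measure_union_null ?_ ?_)
    · have h1 := hK.hausdorffMeasure_image_le zero_le_one {t | ¬ DifferentiableAt ℝ h t}
      rw [hausdorffMeasure_real, ae_iff.1 hK.ae_differentiableAt_real, mul_zero] at h1
      exact nonpos_iff_eq_zero.1 h1
    · exact volume_image_hasDerivAt_zero h
  filter_upwards [measure_eq_zero_iff_ae_notMem.1 hbad] with s hs t ht h0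
  exact hs ⟨t, h0, ht⟩

/-- An infinite fibre in a compact set accumulates at one of its points, but a nonzero derivative
isolates each of them. -/
theorem finite_inter_preimage_of_deriv_ne_zero {h : ℝ → ℝ} {I : Set ℝ} (hI : IsCompact I)
    {s : ℝ} (hc : Continuous h) (hd : ∀ t ∈ I, h t = s → deriv h t ≠ 0) :
    (I ∩ h ⁻¹' {s}).Finite := by
  by_contra hinf
  obtain ⟨t, ht, hacc⟩ := Set.Infinite.exists_accPt_of_subset_isCompact hinf
    (hI.inter_right (isClosed_singleton.preimage hc)) Subset.rfl
  have hne := hd t ht.1 ht.2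
  have h1 : ∀ᶠ z in nhdsWithin t {t}ᶜ, h z ≠ s :=
    (differentiableAt_of_deriv_ne_zero hne).hasDerivAt.eventually_ne hne
  rw [accPt_iff_frequently_nhdsNE] at hacc
  exact hacc (h1.mono fun z hz hz' => hz hz'.2)

/-! ### Degree zero as cancellation of pushforward measures -/

/-- Thickened indicators of a closed set are bounded and Lipschitz and their integrals tend to its
measure; closed sets form a generating π-system. -/
theorem MeasureTheory.Measure.ext_of_forall_lipschitz_integral_eq {X : Type*} [MetricSpace X]
    [MeasurableSpace X] [BorelSpace X] {μ ν : Measure X} [IsFiniteMeasure μ] [IsFiniteMeasure ν]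
    (h : ∀ f : X → ℝ, (∃ K, LipschitzWith K f) → (∃ C, ∀ x, |f x| ≤ C) →
      ∫ x, f x ∂μ = ∫ x, f x ∂ν) : μ = ν := by
  have hcl (F : Set X) (hF : IsClosed F) : μ F = ν F := by
    have hpos (n : ℕ) : (0 : ℝ) < 1 / (n + 1) := Nat.one_div_pos_of_nat
    have h1 := tendsto_integral_thickenedIndicator_of_isClosed μ hF hpos
      tendsto_one_div_add_atTop_nhds_zero_nat
    have h2 := tendsto_integral_thickenedIndicator_of_isClosed ν hF hpos
      tendsto_one_div_add_atTop_nhds_zero_nat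
    have h3 (n : ℕ) : ∫ ω, (thickenedIndicator (hpos n) F ω : ℝ) ∂μ
        = ∫ ω, (thickenedIndicator (hpos n) F ω : ℝ) ∂ν := by
      refine h _ ⟨_, lipschitzWith_thickenedIndicator (hpos n) F⟩ ⟨1, fun x => ?_⟩
      rw [abs_of_nonneg (NNReal.coe_nonneg _)]
      exact_mod_cast thickenedIndicator_le_one (hpos n) F x
    simp_rw [h3] at h1
    exact (measureReal_eq_measureReal_iff).1 (tendsto_nhds_unique h1 h2)
  exact ext_of_generate_finite _ (BorelSpace.measurable_eq.trans borel_eq_generateFrom_isClosed)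
    isPiSystem_isClosed hcl (hcl univ isClosed_univ)

section Parity

variable {X : Type*} [MetricSpace X] {a b : ℝ}

theorem LipschitzWith.IccExtend (hab : a ≤ b) {γ : Icc a b → X} {K : NNReal}
    (hγ : LipschitzWith K γ) : LipschitzWith K (IccExtend hab γ) := by
  have := hγ.comp (LipschitzWith.projIcc hab)
  rwa [mul_one] at this

/-- Degree zero tests the pushforward of `h' dt` against all Lipschitz `f`; splitting `h'` into
positive and negative parts turns its vanishing into an equality of finite measures. -/
theorem HasDegreeZero.map_withDensity_eq [MeasurableSpace X] [BorelSpace X] {hab : a ≤ b}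
    {γ : Icc a b → X} (h0 : HasDegreeZero hab γ) (hγ : ∃ K, LipschitzWith K γ) {g : X → ℝ}
    (hg : ∃ K, LipschitzWith K g) :
    ((volume.restrict (Ioc a b)).withDensity
        fun t => ENNReal.ofReal (deriv (fun s => g (Set.IccExtend hab γ s)) t)).map
        (Set.IccExtend hab γ) =
      ((volume.restrict (Ioc a b)).withDensity
        fun t => ENNReal.ofReal (-deriv (fun s => g (Set.IccExtend hab γ s)) t)).map
        (Set.IccExtend hab γ) := by
  obtain ⟨K, hK⟩ := hγ
  obtain ⟨M, hM⟩ := hg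
  have hG := hK.IccExtend hab
  set G := Set.IccExtend hab γ
  have hh : LipschitzWith (M * K) fun s => g (G s) := hM.comp hG
  set h := fun s => g (G s)
  have hdm : Measurable (deriv h) := measurable_deriv h
  have hdm' : Measurable fun t => -deriv h t := hdm.neg
  have hdi : IntegrableOn (deriv h) (Ioc a b) :=
    (intervalIntegrable_iff_integrableOn_Ioc_of_le hab).1
      (hh.lipschitzOnWith.absolutelyContinuousOnInterval).intervalIntegrable_deriv
  have hdi' : IntegrableOn (fun t => -deriv h t) (Ioc a b) := hdi.neg
  have hfin1 : IsFiniteMeasure ((volume.restrict (Ioc a b)).withDensity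
      fun t => ENNReal.ofReal (deriv h t)) := isFiniteMeasure_withDensity_ofReal hdi.2
  have hfin2 : IsFiniteMeasure ((volume.restrict (Ioc a b)).withDensity
      fun t => ENNReal.ofReal (-deriv h t)) := isFiniteMeasure_withDensity_ofReal hdi'.2
  refine Measure.ext_of_forall_lipschitz_integral_eq fun f hf _ => ?_
  have hzero := h0 f g hf ⟨M, hM⟩
  obtain ⟨L, hL⟩ := hf
  have hfG : Continuous fun t => f (G t) := hL.continuous.comp hG.continuous
  rw [integral_map hG.continuous.measurable.aemeasurable
      hL.continuous.measurable.aestronglyMeasurable,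
    integral_map hG.continuous.measurable.aemeasurable
      hL.continuous.measurable.aestronglyMeasurable,
    integral_withDensity_eq_integral_toReal_smul hdm.ennreal_ofReal (by simp),
    integral_withDensity_eq_integral_toReal_smul hdm'.ennreal_ofReal (by simp)]
  have hint (φ : ℝ → ℝ) (hφ : IntegrableOn φ (Ioc a b)) :
      IntegrableOn (fun t => φ t * f (G t)) (Ioc a b) := by
    rw [← intervalIntegrable_iff_integrableOn_Ioc_of_le hab] at hφ ⊢
    exact hφ.mul_continuousOn hfG.continuousOn
  rw [← sub_eq_zero]
  simp only [smul_eq_mul, ENNReal.toReal_ofReal']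
  rw [← integral_sub (hint _ hdi.pos_part) (hint _ hdi'.pos_part)]
  rw [pathIntegral, intervalIntegral.integral_of_le hab] at hzero
  refine Eq.trans (integral_congr_ae (ae_of_all _ fun t => ?_)) hzero
  change max (deriv h t) 0 * f (G t) - max (-deriv h t) 0 * f (G t) = f (G t) * deriv h t
  rw [← sub_mul, max_zero_sub_eq_self, mul_comm]

/-- In a degree zero path, the preimages of almost every level of `g` cancel. -/
theorem HasDegreeZero.ae_count_eq [MeasurableSpace X] [BorelSpace X] {hab : a ≤ b}
    {γ : Icc a b → X} (h0 : HasDegreeZero hab γ) (hγ : ∃ K, LipschitzWith K γ) {g : X → ℝ}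
    (hg : ∃ K, LipschitzWith K g) {B : Set X} (hB : MeasurableSet B) :
    ∀ᵐ s, Measure.count ({t ∈ Ioc a b | Set.IccExtend hab γ t ∈ B ∧
          0 < deriv (fun s => g (Set.IccExtend hab γ s)) t} ∩
          (fun s => g (Set.IccExtend hab γ s)) ⁻¹' {s}) =
        Measure.count ({t ∈ Ioc a b | Set.IccExtend hab γ t ∈ B ∧
          deriv (fun s => g (Set.IccExtend hab γ s)) t < 0} ∩
          (fun s => g (Set.IccExtend hab γ s)) ⁻¹' {s}) := by
  have hmap := h0.map_withDensity_eq hγ hg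
  obtain ⟨K, hK⟩ := hγ
  obtain ⟨M, hM⟩ := hg
  have hG := hK.IccExtend hab
  set G := Set.IccExtend hab γ
  have hh : LipschitzWith (M * K) fun s => g (G s) := hM.comp hG
  set h := fun s => g (G s)
  have hGm : Measurable G := hG.continuous.measurable
  have hhm : Measurable h := hh.continuous.measurable
  have hdm : Measurable (deriv h) := measurable_deriv h
  set P := {t ∈ Ioc a b | G t ∈ B ∧ 0 < deriv h t} with hP
  set N := {t ∈ Ioc a b | G t ∈ B ∧ deriv h t < 0} with hN
  have hPm : MeasurableSet P :=
    measurableSet_Ioc.inter ((hGm hB).inter (hdm measurableSet_Ioi))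
  have hNm : MeasurableSet N :=
    measurableSet_Ioc.inter ((hGm hB).inter (hdm measurableSet_Iio))
  have hPd : ∀ t ∈ P, deriv h t ≠ 0 := fun t ht => ht.2.2.ne'
  have hNd : ∀ t ∈ N, deriv h t ≠ 0 := fun t ht => ht.2.2.ne
  have areaP (C : Set ℝ) (hC : MeasurableSet C) := setLIntegral_abs_deriv_eq_lintegral_count
    hh.continuous (hPm.inter (hhm hC)) fun t ht => hPd t ht.1
  have areaN (C : Set ℝ) (hC : MeasurableSet C) := setLIntegral_abs_deriv_eq_lintegral_count
    hh.continuous (hNm.inter (hhm hC)) fun t ht => hNd t ht.1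
  have hloc (A C : Set ℝ) (hC : MeasurableSet C) :
      ∫⁻ s, Measure.count (A ∩ h ⁻¹' C ∩ h ⁻¹' {s}) = ∫⁻ s in C, Measure.count (A ∩ h ⁻¹' {s}) := by
    rw [← lintegral_indicator hC]
    refine lintegral_congr fun s => ?_
    by_cases hs : s ∈ C
    · rw [indicator_of_mem hs]
      congr 1
      ext t
      simp only [mem_inter_iff, mem_preimage, mem_singleton_iff]
      constructor
      · exact fun ht => ⟨ht.1.1, ht.2⟩
      · rintro ⟨ht, rfl⟩
        exact ⟨⟨ht, hs⟩, rfl⟩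
    · rw [indicator_of_notMem hs]
      have : A ∩ h ⁻¹' C ∩ h ⁻¹' {s} = ∅ := by
        ext t
        simp only [mem_inter_iff, mem_preimage, mem_singleton_iff, mem_empty_iff_false, iff_false]
        rintro ⟨⟨-, ht⟩, rfl⟩
        exact hs ht
      rw [this, measure_empty]
  have hmeas (A : Set ℝ) (hA : MeasurableSet A) (hAd : ∀ t ∈ A, deriv h t ≠ 0) :
      Measurable fun s => Measure.count (A ∩ h ⁻¹' {s}) :=
    (setLIntegral_abs_deriv_eq_lintegral_count hh.continuous hA hAd).2
  -- The two counts are compared by integrating over an arbitrary Borel set `C` of levels: this is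
  -- the equality of pushforwards on `B ∩ g ⁻¹' C`, read through the area formula.
  refine ae_eq_of_forall_setLIntegral_eq_of_sigmaFinite (hmeas P hPm hPd) (hmeas N hNm hNd)
    fun C hC _ => ?_
  have hgm : Measurable g := hM.continuous.measurable
  have hBC : MeasurableSet (B ∩ g ⁻¹' C) := hB.inter (hgm hC)
  rw [← hloc P C hC, ← hloc N C hC, ← (areaP C hC).1, ← (areaN C hC).1]
  have hval := congrArg (fun μ => μ (B ∩ g ⁻¹' C)) hmap
  simp only [Measure.map_apply hGm hBC, withDensity_apply _ (hGm hBC)] at hval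
  rw [Measure.restrict_restrict (hGm hBC)] at hval
  have hset (φ : ℝ → ℝ) (hφ : Measurable φ) (A : Set ℝ) (hA : MeasurableSet A)
      (hAφ : A = {t ∈ Ioc a b | G t ∈ B ∧ 0 < φ t}) (hφd : ∀ t ∈ A, φ t = |deriv h t|) :
      ∫⁻ t in G ⁻¹' (B ∩ g ⁻¹' C) ∩ Ioc a b, ENNReal.ofReal (φ t)
        = ∫⁻ t in A ∩ h ⁻¹' C, ENNReal.ofReal |deriv h t| := by
    rw [← lintegral_indicator ((hGm hBC).inter measurableSet_Ioc),
      ← lintegral_indicator (hA.inter (hhm hC))]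
    refine lintegral_congr fun t => ?_
    by_cases ht : t ∈ A ∩ h ⁻¹' C
    · rw [indicator_of_mem ht, ← hφd t ht.1]
      have ht1 := ht.1
      rw [hAφ] at ht1
      exact indicator_of_mem (show t ∈ G ⁻¹' (B ∩ g ⁻¹' C) ∩ Ioc a b from
        ⟨⟨ht1.2.1, ht.2⟩, ht1.1⟩) _
    · rw [indicator_of_notMem ht]
      by_cases ht' : t ∈ G ⁻¹' (B ∩ g ⁻¹' C) ∩ Ioc a b
      · rw [indicator_of_mem ht', ENNReal.ofReal_eq_zero]
        by_contra hpos
        refine ht ⟨?_, ht'.1.2⟩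
        rw [hAφ]
        exact ⟨ht'.2, ht'.1.1, not_le.1 hpos⟩
      · rw [indicator_of_notMem ht']
  rwa [hset (deriv h) hdm P hPm hP fun t ht => (abs_of_pos ht.2.2).symm,
    hset (fun t => -deriv h t) hdm.neg N hNm (by simp only [hN, neg_pos])
      fun t ht => (abs_of_neg ht.2.2).symm] at hval

end Parity

/-! ### Negligible image of the metrically critical times -/

/-- If a Lipschitz curve has vanishing derivative, tested against all distance functions to points
of a dense subset of the curve, at each point of `Z`, then the image of `Z` is negligible. -/
theorem LipschitzWith.hausdorffMeasure_image_eq_zero {X : Type*} [MetricSpace X]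
    [MeasurableSpace X] [BorelSpace X] {G : ℝ → X} {K : NNReal} (hG : LipschitzWith K G) :
    (μH[1] : Measure X)
      (G '' {t | ∀ q : ℚ, deriv (fun s => dist (G s) (G q)) t = 0}) = 0 := by
  have hlip (q : ℚ) : LipschitzWith K fun s => dist (G s) (G q) := by
    have := (LipschitzWith.dist_left (G q)).comp hG
    rwa [one_mul] at this
  set Z : Set ℝ := {t | ∀ q : ℚ, deriv (fun s => dist (G s) (G q)) t = 0} with hZ
  have hZm : MeasurableSet Z := by
    rw [hZ, ofPred_forall]
    exact MeasurableSet.iInter fun q => (measurable_deriv _) (measurableSet_singleton (0 : ℝ))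
  set φ : ℝ → ℝ := Zᶜ.indicator fun _ => (K : ℝ) with hφ
  have hφi : LocallyIntegrable φ :=
    (locallyIntegrable_const (K : ℝ)).indicator hZm.compl
  have hφii (x y : ℝ) : IntervalIntegrable φ volume x y := 
    (LocallyIntegrable.integrableOn_isCompact hφi isCompact_uIcc).intervalIntegrable
  -- `F` grows at rate `K` off `Z` and not at all on `Z`. It dominates the increments of every
  -- distance to `G q`, hence by density those of `G` itself.
  set F : ℝ → ℝ := fun t => ∫ r in (0 : ℝ)..t, φ r with hF
  have hdist1 (s t : ℝ) (hst : s ≤ t) (q : ℚ) :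
      |dist (G t) (G q) - dist (G s) (G q)| ≤ F t - F s := by
    rw [← (hlip q).integral_deriv_eq_sub, hF,
      intervalIntegral.integral_interval_sub_left (hφii _ _) (hφii _ _), ← Real.norm_eq_abs]
    refine intervalIntegral.norm_integral_le_of_norm_le hst (ae_of_all _ fun r _ => ?_) (hφii _ _)
    by_cases hr : r ∈ Z
    · rw [hr q, norm_zero, hφ, indicator_of_notMem (not_not.2 hr)]
    · rw [hφ, indicator_of_mem (show r ∈ Zᶜ from hr)]
      exact norm_deriv_le_of_lipschitz (hlip q)
  have hdist2 (s t : ℝ) (hst : s ≤ t) : dist (G s) (G t) ≤ |F s - F t| := by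
    have hall (r : ℝ) : |dist (G t) (G r) - dist (G s) (G r)| ≤ F t - F s := by
      refine isClosed_property (p := fun r => |dist (G t) (G r) - dist (G s) (G r)| ≤ F t - F s)
        Rat.denseRange_cast ?_ (hdist1 s t hst) r
      have := hG.continuous
      exact isClosed_le (by fun_prop) continuous_const
    have h1 := hall s
    rw [dist_self, sub_zero, abs_of_nonneg dist_nonneg, dist_comm] at h1
    rw [abs_sub_comm]
    exact h1.trans (le_abs_self _)
  have hdist (s t : ℝ) : dist (G s) (G t) ≤ |F s - F t| := by
    rcases le_total s t with h | h
    · exact hdist2 s t h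
    · rw [dist_comm, abs_sub_comm]
      exact hdist2 t s h
  set Z₁ : Set ℝ := {t | HasDerivAt F 0 t} with hZ₁
  have hnull : volume (Z \ Z₁) = 0 := by
    rw [measure_eq_zero_iff_ae_notMem]
    filter_upwards [LocallyIntegrable.ae_hasDerivAt_integral hφi] with t ht htZ
    have h1 := ht 0
    rw [hφ, indicator_of_notMem (not_not.2 htZ.1)] at h1
    exact htZ.2 h1
  -- On `Z₁` the curve factors through `F` by a 1-Lipschitz map, and `F '' Z₁` is a set of critical
  -- values, hence null.
  have hsub : G '' Z ⊆ (G ∘ Function.invFunOn F Z₁) '' (F '' Z₁) ∪ G '' (Z \ Z₁) := by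
    rintro _ ⟨t, ht, rfl⟩
    by_cases h1 : t ∈ Z₁
    · refine Or.inl ⟨F t, mem_image_of_mem F h1, ?_⟩
      have h2 := hdist (Function.invFunOn F Z₁ (F t)) t
      rw [Function.invFunOn_eq (mem_image_of_mem F h1), sub_self, abs_zero] at h2
      exact dist_le_zero.1 h2
    · exact Or.inr ⟨t, ⟨ht, h1⟩, rfl⟩
  refine measure_mono_null hsub (measure_union_null ?_ ?_)
  · have hL : LipschitzOnWith 1 (G ∘ Function.invFunOn F Z₁) (F '' Z₁) := by
      refine LipschitzOnWith.of_dist_le_mul fun y hy z hz => ?_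
      have h1 := hdist (Function.invFunOn F Z₁ y) (Function.invFunOn F Z₁ z)
      rw [Function.invFunOn_eq hy, Function.invFunOn_eq hz] at h1
      rwa [NNReal.coe_one, one_mul, Real.dist_eq]
    have h1 := hL.hausdorffMeasure_image_le zero_le_one
    rw [hausdorffMeasure_real, volume_image_hasDerivAt_zero, mul_zero] at h1
    exact nonpos_iff_eq_zero.1 h1
  · have h1 := hG.hausdorffMeasure_image_le zero_le_one (Z \ Z₁)
    rw [hausdorffMeasure_real, hnull, mul_zero] at h1
    exact nonpos_iff_eq_zero.1 h1

/-! ### Parity on level sets and on the whole space -/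

section Parity

variable {X : Type*} [MetricSpace X] [MeasurableSpace X] [BorelSpace X] {a b : ℝ}

/-- The multiplicity of a degree zero path is finite and even on almost every level set of a
Lipschitz function. -/
theorem HasDegreeZero.ae_forall_even {hab : a ≤ b} {γ : Icc a b → X} (h0 : HasDegreeZero hab γ)
    (hγ : ∃ K, LipschitzWith K γ) {g : X → ℝ} (hg : ∃ K, LipschitzWith K g) :
    ∀ᵐ s, ∀ x, g x = s → pathMultiplicity γ x ≠ ⊤ ∧ Even (pathMultiplicity γ x) := by
  -- Only countably many balls are used, so one null set of levels serves all of them.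
  have hcount (q : ℚ) (n : ℕ) := h0.ae_count_eq hγ hg
    (B := Metric.ball (Set.IccExtend hab γ q) (1 / (n + 1))) measurableSet_ball
  obtain ⟨K, hK⟩ := hγ
  obtain ⟨M, hM⟩ := hg
  have hG := hK.IccExtend hab
  have hGγ (t : Icc a b) : Set.IccExtend hab γ t = γ t := IccExtend_val hab γ t
  set G := Set.IccExtend hab γ
  have hh : LipschitzWith (M * K) fun s => g (G s) := hM.comp hG
  set h := fun s => g (G s) with hh_def
  -- The level `h a` is discarded because the counts are over `Ioc a b`, which omits `a`.
  filter_upwards [ae_all_iff.2 fun q => ae_all_iff.2 (hcount q), hh.ae_forall_deriv_ne_zero,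
    measure_eq_zero_iff_ae_notMem.1 (measure_singleton (h a))] with s hs hd hsa x hx
  by_cases hxγ : x ∈ range γ
  swap
  · have : γ ⁻¹' {x} = ∅ := by
      ext t
      simp only [mem_preimage, mem_singleton_iff, mem_empty_iff_false, iff_false]
      exact fun h => hxγ ⟨t, h⟩
    simp [pathMultiplicity, this]
  obtain ⟨t₀, ht₀⟩ := hxγ
  have hF : (Icc a b ∩ h ⁻¹' {s}).Finite :=
    finite_inter_preimage_of_deriv_ne_zero isCompact_Icc hh.continuous fun t _ => hd t
  set F := Icc a b ∩ h ⁻¹' {s} with hF_def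
  -- The curve meets the level `s` in finitely many points, so a small ball from the countable
  -- family contains `x` and none of the others.
  have hcl : (G '' F \ {x})ᶜ ∈ nhds x :=
    ((hF.image G).sdiff.isClosed.isOpen_compl).mem_nhds (by simp)
  obtain ⟨δ, hδ, hball⟩ := Metric.mem_nhds_iff.1 hcl
  obtain ⟨n, hn⟩ := exists_nat_one_div_lt (half_pos hδ)
  obtain ⟨q, hq⟩ := (Rat.denseRange_cast (𝕜 := ℝ)).exists_mem_open
    (Metric.isOpen_ball.preimage hG.continuous)
    ⟨(t₀ : ℝ), show G t₀ ∈ Metric.ball x (1 / (n + 1)) by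
      rw [hGγ, ht₀]; exact Metric.mem_ball_self (by positivity)⟩
  have hq' : dist (G q) x < 1 / (n + 1) := hq
  have hsep : ∀ t ∈ F, G t ∈ Metric.ball (G q) (1 / (n + 1)) ↔ G t = x := by
    intro t ht
    constructor
    · intro htB
      have h1 : G t ∈ Metric.ball x δ := by
        have := dist_triangle (G t) (G q) x
        rw [Metric.mem_ball] at htB ⊢
        linarith
      by_contra hne
      exact hball h1 ⟨mem_image_of_mem G ht, hne⟩
    · rintro rfl
      rw [Metric.mem_ball, dist_comm]
      exact hq'
  have hset (p : ℝ → Prop) : {t ∈ Ioc a b | G t ∈ Metric.ball (G q) (1 / (n + 1)) ∧ p t} ∩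
      h ⁻¹' {s} = {t | t ∈ Icc a b ∧ G t = x ∧ p t} := by
    ext t
    constructor
    · rintro ⟨⟨ht, htB, hp⟩, hts⟩
      have ht' := Ioc_subset_Icc_self ht
      exact ⟨ht', (hsep t ⟨ht', hts⟩).1 htB, hp⟩
    · rintro ⟨ht, htx, hp⟩
      have hts : h t = s := by rw [hh_def]; simp only [htx, hx]
      have hta : t ≠ a := by
        rintro rfl
        exact hsa hts.symm
      exact ⟨⟨⟨lt_of_le_of_ne ht.1 hta.symm, ht.2⟩, (hsep t ⟨ht, hts⟩).2 htx, hp⟩, hts⟩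
  have hc := hs q n
  rw [hset, hset] at hc
  set P := {t | t ∈ Icc a b ∧ G t = x ∧ 0 < deriv h t} with hP
  set N := {t | t ∈ Icc a b ∧ G t = x ∧ deriv h t < 0} with hN
  have hPF : P ⊆ F := fun t ht => ⟨ht.1, by simp [hh_def, ht.2.1, hx]⟩
  have hNF : N ⊆ F := fun t ht => ⟨ht.1, by simp [hh_def, ht.2.1, hx]⟩
  rw [Measure.count_apply (hF.subset hPF).measurableSet,
    Measure.count_apply (hF.subset hNF).measurableSet, ENat.toENNReal_inj] at hc
  have himg : Subtype.val '' (γ ⁻¹' {x}) = P ∪ N := by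
    ext t
    constructor
    · rintro ⟨t, ht, rfl⟩
      have htx : G t = x := by rw [hGγ]; exact ht
      have hts : h t = s := by rw [hh_def]; simp only [htx, hx]
      rcases lt_or_gt_of_ne (hd t hts) with h1 | h1
      · exact Or.inr ⟨t.2, htx, h1⟩
      · exact Or.inl ⟨t.2, htx, h1⟩
    · have key : t ∈ Icc a b → G t = x → t ∈ Subtype.val '' (γ ⁻¹' {x}) := fun ht htx =>
        ⟨⟨t, ht⟩, (hGγ ⟨t, ht⟩).symm.trans htx, rfl⟩
      rintro (ht | ht) <;> exact key ht.1 ht.2.1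
  have hdisj : Disjoint P N :=
    disjoint_left.2 fun t htP htN => lt_asymm htP.2.2 htN.2.2
  have hmul : pathMultiplicity γ x = P.encard + P.encard := by
    rw [pathMultiplicity, ← Subtype.val_injective.encard_image, himg, encard_union_eq hdisj, hc]
  rw [hmul]
  have hPtop : P.encard ≠ ⊤ := encard_ne_top_iff.2 (hF.subset hPF)
  exact ⟨by simpa using hPtop, ⟨_, rfl⟩⟩

theorem HasDegreeZero.ae_even_pathMultiplicity {hab : a ≤ b} {γ : Icc a b → X}
    (h0 : HasDegreeZero hab γ) (hγ : ∃ K, LipschitzWith K γ) :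
    ∀ᵐ x ∂(μH[1] : Measure X), pathMultiplicity γ x ≠ ⊤ ∧ Even (pathMultiplicity γ x) := by
  have hev (y : X) := h0.ae_forall_even hγ (g := fun z => dist z y)
    ⟨1, LipschitzWith.dist_left y⟩
  obtain ⟨K, hK⟩ := hγ
  have hG := hK.IccExtend hab
  have hGγ (t : Icc a b) : Set.IccExtend hab γ t = γ t := IccExtend_val hab γ t
  set G := Set.IccExtend hab γ
  rw [ae_iff]
  set E := {x | ¬(pathMultiplicity γ x ≠ ⊤ ∧ Even (pathMultiplicity γ x))}
  set Z : Set ℝ := {t | ∀ q : ℚ, deriv (fun s => dist (G s) (G q)) t = 0}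
  -- Almost every value of the distance to `y` is attained at no point of `E`.
  have hEnull (y : X) : volume ((fun z => dist z y) '' E) = 0 := by
    rw [measure_eq_zero_iff_ae_notMem]
    filter_upwards [hev y] with s hs
    rintro ⟨x, hxE, hx⟩
    exact hxE (hs x hx)
  have hcont (q : ℚ) : Continuous fun s => dist (G s) (G q) :=
    hG.continuous.dist continuous_const
  have hbad : volume {t | G t ∈ E ∧ t ∉ Z} = 0 := by
    rw [measure_eq_zero_iff_ae_notMem]
    filter_upwards [ae_all_iff.2 fun q : ℚ =>
      ae_deriv_eq_zero_of_mem_null (hcont q) (hEnull (G q))] with t ht htE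
    exact htE.2 fun q => ht q (mem_image_of_mem _ htE.1)
  have hsub : E ⊆ G '' Z ∪ G '' {t | G t ∈ E ∧ t ∉ Z} := by
    intro x hx
    have hne : (γ ⁻¹' {x}).Nonempty := by
      rw [nonempty_iff_ne_empty]
      intro hempty
      exact hx (by simp [pathMultiplicity, hempty])
    obtain ⟨t, ht⟩ := hne
    have htx : G t = x := (hGγ t).trans ht
    by_cases htZ : (t : ℝ) ∈ Z
    · exact Or.inl ⟨t, htZ, htx⟩
    · exact Or.inr ⟨t, ⟨by rwa [htx], htZ⟩, htx⟩
  refine measure_mono_null hsub (measure_union_null hG.hausdorffMeasure_image_eq_zero ?_)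
  have h1 := hG.hausdorffMeasure_image_le zero_le_one {t | G t ∈ E ∧ t ∉ Z}
  rw [hausdorffMeasure_real, hbad, mul_zero] at h1
  exact nonpos_iff_eq_zero.1 h1

end Parity

theorem mainTheorem6 {X : Type*} [MetricSpace X] [MeasurableSpace X] [BorelSpace X]
    {a b : ℝ} (hab : a ≤ b) (γ : Icc a b → X) (hγ : ∃ K, LipschitzWith K γ)
    (f g : X → ℝ) (hf : ∃ K, LipschitzWith K f) (hg : ∃ K, LipschitzWith K g) :
    -- (i) invariance under reparametrization
    (∀ (c d : ℝ) (hcd : c ≤ d) (τ : Icc c d ≃ₜ Icc a b), StrictMono τ →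
      (∃ K, LipschitzWith K (γ ∘ τ)) →
        pathIntegral hab γ f g = pathIntegral hcd (γ ∘ τ) f g ∧
          (HasDegreeZero hab γ ↔ HasDegreeZero hcd (γ ∘ τ))) ∧
    -- (ii) stability
    (∀ γs : ℕ → Icc a b → X, (∃ K, ∀ n, LipschitzWith K (γs n)) →
      TendstoUniformly γs γ atTop →
        Tendsto (fun n => pathIntegral hab (γs n) f g) atTop (nhds (pathIntegral hab γ f g)) ∧
          ((∀ n, HasDegreeZero hab (γs n)) → HasDegreeZero hab γ)) ∧
    -- (iii) parity
    (HasDegreeZero hab γ →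
      ∀ᵐ x ∂(μH[1] : Measure X), pathMultiplicity γ x ≠ ⊤ ∧ Even (pathMultiplicity γ x)) := by
  refine ⟨fun c d hcd τ hτ hγτ => ?_, fun γs hγs hunif => ?_, fun h0 =>
    h0.ae_even_pathMultiplicity hγ⟩
  · have key {f g : X → ℝ} (hf : ∃ K, LipschitzWith K f) (hg : ∃ K, LipschitzWith K g) :=
      pathIntegral_comp_homeomorph hab hcd τ hτ hγ hγτ hf hg
    refine ⟨key hf hg, fun h φ ψ hφ hψ => ?_, fun h φ ψ hφ hψ => ?_⟩
    · rw [← key hφ hψ]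
      exact h φ ψ hφ hψ
    · rw [key hφ hψ]
      exact h φ ψ hφ hψ
  · have hlim := fun t => hunif.tendsto_at t
    refine ⟨tendsto_pathIntegral hab hγ hγs hlim hf hg, fun h φ ψ hφ hψ => ?_⟩
    have h1 := tendsto_pathIntegral hab hγ hγs hlim hφ hψ
    simp only [fun n => h n φ ψ hφ hψ] at h1
    exact tendsto_nhds_unique h1 tendsto_const_nhds
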